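/- For an integer $v \ge 2$ let $K_v$ be the complete graph on $\{0,1,\dots,v-1\}$, and let the length of the edge $\{i,j\}$ be $\min(|i-j|,\,v-|i-j|)$. A multiset $L$ of positive integers is *realizable* (at $v$) if it is the multiset of edge lengths of some Hamiltonian path in $K_v$. Its support $\operatorname{supp}(L)$ is the set of its elements. The BHR (Buratti–Horak–Rosa) Conjecture holds at $v$ for a set $S$ if every multiset $L$ of size $v-1$ with $\operatorname{supp}(L)=S\subseteq\{1,\dots,\lfloor v/2\rfloor\}$ satisfies: $L$ is realizable if and only if for every divisor $d$ of $v$ the number of multiples of $d$ in $L$, counted with multiplicity, is at most $v-d$. The Coprime BHR Conjecture holds at $v$ for $S$ if every such $L$ with $\gcd(v,\ell)=1$ for all $\ell\in L$ is realizable. **Theorem.** Let $x,y$ be positive integers with $x>2$ and $y > \dfrac{2x^2+2x+1}{x-2}$. 1. There is an $N$, depending only on $x$ and $y$, such that for every $v\ge N$ with $v\equiv 1$ or $v\equiv -1 \pmod{xy}$ the BHR Conjecture holds at $v$ for $\{1,x,y\}$. 2. For every $v\equiv\pm1\pmod{xy}$, each multiset $L$ of size $v-1$ with $\operatorname{supp}(L)=\{1,x,y\}\subseteq\{1,\dots,\lfloor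 v/2\rfloor\}$ has all its elements coprime to $v$; that is, it is an instance of the Coprime BHR Conjecture. 3. Consequently there are infinitely many $v\equiv\pm1\pmod{xy}$ for which such multisets $L$ exist and at which both the BHR Conjecture and the Coprime BHR Conjecture hold for $\{1,x,y\}$. -/

import Mathlib

namespace BHR

/-- The (cyclic) length `min (|i - j|) (v - |i - j|)` of an edge `{i, j}` of the complete graph
on the vertex set `{0, 1, …, v - 1}`. -/
def edgeLength (v : ℕ) : Sym2 (Fin v) → ℕ :=
  Sym2.lift ⟨fun i j => min (Nat.dist i j) (v - Nat.dist i j), fun i j => by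
    simp only [Nat.dist_comm]⟩

/-- The multiset `L` is realizable on `v` vertices: it is the multiset of lengths of the edges of
some Hamiltonian path in the complete graph on `{0, 1, …, v - 1}`. -/
def Realizable (v : ℕ) (L : Multiset ℕ) : Prop :=
  ∃ (s t : Fin v) (p : (⊤ : SimpleGraph (Fin v)).Walk s t),
    p.IsHamiltonian ∧ (p.edges : Multiset (Sym2 (Fin v))).map (edgeLength v) = L

/-- `L` has size `v - 1` and support contained in `{1, 2, …, ⌊v / 2⌋}`. -/
def IsInstance (v : ℕ) (L : Multiset ℕ) : Prop :=
  L.card + 1 = v ∧ ∀ l ∈ L, 1 ≤ l ∧ l ≤ v / 2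

/-- For every divisor `d` of `v`, the number of multiples of `d` in `L` (counted with
multiplicity) is at most `v - d`. -/
def DivisorCondition (v : ℕ) (L : Multiset ℕ) : Prop :=
  ∀ d : ℕ, d ∣ v → (L.filter (fun l => d ∣ l)).card ≤ v - d

/-- The Buratti–Horak–Rosa Conjecture holds at `v` for all multisets with support `S`. -/
def BHRHoldsFor (v : ℕ) (S : Finset ℕ) : Prop :=
  ∀ L : Multiset ℕ, L.toFinset = S → IsInstance v L → (Realizable v L ↔ DivisorCondition v L)

/-- `L` is an instance of the Coprime BHR Conjecture: in addition to the size and support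
conditions, every element of `L` is coprime to `v`. -/
def IsCoprimeInstance (v : ℕ) (L : Multiset ℕ) : Prop :=
  IsInstance v L ∧ ∀ l ∈ L, Nat.gcd v l = 1

/-- The Coprime BHR Conjecture holds at `v` for all multisets with support `S`. -/
def CoprimeBHRHoldsFor (v : ℕ) (S : Finset ℕ) : Prop :=
  ∀ L : Multiset ℕ, L.toFinset = S → IsCoprimeInstance v L → Realizable v L

end BHR

/-!
The proof combines a construction on the integers with multiplication by units modulo `v`.

*Linear construction* (`BHR.exists_pathOn_three`). If `a ≥ X + Y + 1`, then
`{0, …, a + b + c}` has a Hamiltonian path whose multiset of differences `|i - j|`, taken in `ℕ`, is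
`{1^a, X^b, Y^c}`. It is enough to treat `X` and `Y` separately: `BHR.exists_pathOn_one_x` gives, for
every `b`, a path on an initial segment of `ℕ` that starts at `0` and has `b` differences `X` and at
most `X` differences `1`. One such path for `X`, reflected so that it ends at its largest vertex, a
run of consecutive integers, and one such path for `Y` are laid end to end. The path for `X` is a
zigzag along the columns of the grid with rows of length `X`, that is, along the residue classes
modulo `X`. The last row of the grid is incomplete, and a column can only be left at the top if the
next one is equally high; several variants of the zigzag, according to parities, deal with this.

*Units* (`BHR.PathOn.realizable`). Multiplying the vertices of such a path by a unit `u` modulo `v`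
gives a Hamiltonian path of `K_v` in which a difference `d` has become the cyclic length of `u * d`.
Let `v = k * x * y ± 1`, so that `x`, `y` are units. A multiset `{1^a, x^b, y^c}` of size `v - 1` is
obtained from `{1^c, (k * x)^a, (k * x ^ 2)^b}` through multiplication by `y`, since `k * x * y ≡ ∓1`,
and from `{1^b, (k * y)^a, Y^c}` through multiplication by `x`, where `Y ≤ v / 2` is the cyclic length
of `k * y ^ 2`. So it is realizable if `a ≥ x + y + 1`, or `c ≥ k * x + k * x ^ 2 + 1`, or
`b ≥ k * y + Y + 1`. As `a + b + c = v - 1`, one of these holds for large `k` as soon as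
`x * y ≥ 2 * (x ^ 2 + x + y) + 2`, which is the hypothesis on `y` for integers
(`BHR.realizable_three`).

Since `x` and `y` are coprime to `v`, the divisor condition holds for each of these multisets, so both
sides of the equivalence in the BHR Conjecture are true.
-/

namespace BHR

/-! ### Paths on sets of natural numbers -/

/-- The multiset of the distances `|i - j|` between consecutive entries `i`, `j` of a list. -/
def steps : List ℕ → Multiset ℕ
  | [] => 0
  | [_] => 0
  | i :: j :: l => Nat.dist i j ::ₘ steps (j :: l)

/-- `PathOn S s t M`: some sequence runs from `s` to `t`, visits every element of `S` exactly once
and nothing else, and has `M` as the multiset of distances between consecutive entries. Distances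
are taken in `ℕ`, not cyclically. -/
def PathOn (S : Set ℕ) (s t : ℕ) (M : Multiset ℕ) : Prop :=
  ∃ l : List ℕ, l.Nodup ∧ (∀ n, n ∈ l ↔ n ∈ S) ∧ l.head? = some s ∧ l.getLast? = some t ∧
    steps l = M

lemma steps_append : ∀ (l₁ l₂ : List ℕ) (i j : ℕ), l₁.getLast? = some i → l₂.head? = some j →
    steps (l₁ ++ l₂) = steps l₁ + steps l₂ + {Nat.dist i j}
  | [], _, _, _, h, _ => by simp at h
  | [a], l₂, i, j, h, h' => by
      obtain ⟨l, rfl⟩ : ∃ l, l₂ = j :: l := by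
        cases l₂ with
        | nil => simp at h'
        | cons b l => simp at h'; exact ⟨l, by rw [h']⟩
      simp at h
      subst h
      simp [steps, ← Multiset.singleton_add, add_comm]
  | a :: b :: l, l₂, i, j, h, h' => by
      have := steps_append (b :: l) l₂ i j (by simpa using h) h'
      simp only [List.cons_append] at this
      simp [steps, this]

lemma steps_reverse : ∀ l : List ℕ, steps l.reverse = steps l
  | [] => rfl
  | [_] => rfl
  | a :: b :: l => by
      rw [List.reverse_cons, steps_append _ _ b a (by simp) (by simp), steps_reverse (b :: l)]
      simp [steps, ← Multiset.singleton_add, add_comm, Nat.dist_comm]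

lemma steps_map (f : ℕ → ℕ) : ∀ l : List ℕ,
    (∀ i ∈ l, ∀ j ∈ l, Nat.dist (f i) (f j) = Nat.dist i j) → steps (l.map f) = steps l
  | [], _ => rfl
  | [_], _ => rfl
  | a :: b :: l, h => by
      have := steps_map f (b :: l) fun i hi j hj =>
        h i (List.mem_cons_of_mem _ hi) j (List.mem_cons_of_mem _ hj)
      simp only [List.map_cons] at this
      simp [steps, this, h a (by simp) b (by simp)]

lemma card_steps : ∀ l : List ℕ, (steps l).card = l.length - 1
  | [] => rfl
  | [_] => rfl
  | a :: b :: l => by simp [steps, card_steps (b :: l)]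

namespace PathOn

variable {S S₁ S₂ : Set ℕ} {s t s₁ t₁ s₂ t₂ : ℕ} {M M₁ M₂ : Multiset ℕ}

lemma congr (h : PathOn S₁ s t M) (hS : ∀ n, n ∈ S₁ ↔ n ∈ S₂) : PathOn S₂ s t M := by
  obtain ⟨l, h1, h2, h3⟩ := h
  exact ⟨l, h1, fun n => (h2 n).trans (hS n), h3⟩

lemma reverse (h : PathOn S s t M) : PathOn S t s M := by
  obtain ⟨l, h1, h2, h3, h4, h5⟩ := h
  exact ⟨l.reverse, List.nodup_reverse.2 h1, by simpa using h2, by simpa using h4,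
    by simpa using h3, (steps_reverse l).trans h5⟩

lemma append (h₁ : PathOn S₁ s₁ t₁ M₁) (h₂ : PathOn S₂ s₂ t₂ M₂) (hd : ∀ n ∈ S₁, n ∉ S₂) :
    PathOn (S₁ ∪ S₂) s₁ t₂ (M₁ + M₂ + {Nat.dist t₁ s₂}) := by
  obtain ⟨l, h1, h2, h3, h4, h5⟩ := h₁
  obtain ⟨l', h1', h2', h3', h4', h5'⟩ := h₂
  refine ⟨l ++ l', ?_, by simp [h2, h2'], by simp [h3], by simp [h4'], ?_⟩
  · refine List.nodup_append.2 ⟨h1, h1', fun a ha b hb hab => ?_⟩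
    exact hd a ((h2 a).1 ha) ((h2' a).1 (hab ▸ hb))
  · rw [steps_append _ _ _ _ h4 h3', h5, h5']

lemma singleton (n : ℕ) : PathOn {n} n n 0 := ⟨[n], by simp [steps]⟩

lemma shift (h : PathOn S s t M) (k : ℕ) : PathOn {n | k ≤ n ∧ n - k ∈ S} (s + k) (t + k) M := by
  obtain ⟨l, h1, h2, h3, h4, h5⟩ := h
  refine ⟨l.map (· + k), h1.map (add_left_injective k), fun n => ?_, by simp [h3], by simp [h4], ?_⟩
  · simp only [List.mem_map, Set.mem_ofPred_eq, h2]
    constructor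
    · rintro ⟨a, ha, rfl⟩
      exact ⟨by omega, by simpa using ha⟩
    · rintro ⟨ha, hb⟩
      exact ⟨_, hb, by omega⟩
  · rw [steps_map _ _ fun i _ j _ => Nat.dist_add_add_right i k j, h5]

/-- The mirror image of a path on an initial segment of `ℕ`. -/
lemma reflect {v : ℕ} (h : PathOn (Set.Iio (v + 1)) s t M) :
    PathOn (Set.Iio (v + 1)) (v - s) (v - t) M := by
  obtain ⟨l, h1, h2, h3, h4, h5⟩ := h
  refine ⟨l.map (v - ·), ?_, fun n => ?_, by simp [h3], by simp [h4], ?_⟩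
  · refine h1.map_on fun a ha b hb hab => ?_
    have ha := (h2 a).1 ha
    have hb := (h2 b).1 hb
    simp only [Set.mem_Iio] at ha hb
    omega
  · simp only [List.mem_map, h2, Set.mem_Iio]
    constructor
    · rintro ⟨a, ha, rfl⟩
      omega
    · intro hn
      exact ⟨v - n, by omega, by omega⟩
  · rw [steps_map _ _ fun i hi j hj => ?_, h5]
    have hi := (h2 i).1 hi
    have hj := (h2 j).1 hj
    simp only [Set.mem_Iio] at hi hj
    unfold Nat.dist
    omega

lemma card_add_one {v : ℕ} (h : PathOn (Set.Iio v) s t M) : M.card + 1 = v := by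
  obtain ⟨l, h1, h2, h3, -, h5⟩ := h
  have hl : l.length = v := by
    have hf : l.toFinset = Finset.range v := by
      ext n
      simp [h2]
    rw [← List.toFinset_card_of_nodup h1, hf, Finset.card_range]
  have : l ≠ [] := by rintro rfl; simp at h3
  have := List.length_pos_iff.2 this
  rw [← h5, card_steps]
  omega

lemma start_mem (h : PathOn S s t M) : s ∈ S := by
  obtain ⟨l, -, h2, h3, -⟩ := h
  exact (h2 s).1 (List.mem_of_mem_head? h3)

/-- A run of consecutive integers. -/
lemma run (i m : ℕ) : PathOn {n | i ≤ n ∧ n ≤ i + m} i (i + m) (Multiset.replicate m 1) := by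
  induction m with
  | zero => exact (singleton i).congr fun n => by simp; omega
  | succ m ih =>
    have h := (ih.append (singleton (i + m + 1)) fun n hn => by
      simp only [Set.mem_ofPred_eq, Set.mem_singleton_iff] at hn ⊢; omega).congr
      (S₂ := {n | i ≤ n ∧ n ≤ i + (m + 1)}) fun n => by
        simp only [Set.mem_ofPred_eq, Set.mem_singleton_iff, Set.mem_union]; omega
    have hd : Nat.dist (i + m) (i + m + 1) = 1 := by unfold Nat.dist; omega
    rw [hd] at h
    simpa [Multiset.replicate_succ, ← Multiset.singleton_add, add_comm, add_assoc] using h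

end PathOn

/-! ### Zigzags on the grid of residues modulo `x` -/

/-- A path whose steps are `a` ones and some number of `x`s. -/
def GridPath (x : ℕ) (S : Set ℕ) (s t a : ℕ) : Prop :=
  ∃ b, PathOn S s t (Multiset.replicate a 1 + Multiset.replicate b x)

namespace GridPath

variable {x : ℕ} {S S₁ S₂ : Set ℕ} {s t s₁ t₁ s₂ t₂ a a₁ a₂ : ℕ}

lemma congr (h : GridPath x S₁ s t a) (hS : ∀ n, n ∈ S₁ ↔ n ∈ S₂) : GridPath x S₂ s t a :=
  h.imp fun _ hb => hb.congr hS

lemma reverse (h : GridPath x S s t a) : GridPath x S t s a := h.imp fun _ hb => hb.reverse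

lemma append_one (h₁ : GridPath x S₁ s₁ t₁ a₁) (h₂ : GridPath x S₂ s₂ t₂ a₂)
    (hd : ∀ n ∈ S₁, n ∉ S₂) (h : Nat.dist t₁ s₂ = 1) :
    GridPath x (S₁ ∪ S₂) s₁ t₂ (a₁ + a₂ + 1) := by
  obtain ⟨b₁, h₁⟩ := h₁
  obtain ⟨b₂, h₂⟩ := h₂
  refine ⟨b₁ + b₂, ?_⟩
  have := h₁.append h₂ hd
  rw [h] at this
  convert this using 1
  simp only [Multiset.replicate_add, Multiset.replicate_one]
  abel

lemma append_x (h₁ : GridPath x S₁ s₁ t₁ a₁) (h₂ : GridPath x S₂ s₂ t₂ a₂)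
    (hd : ∀ n ∈ S₁, n ∉ S₂) (h : Nat.dist t₁ s₂ = x) :
    GridPath x (S₁ ∪ S₂) s₁ t₂ (a₁ + a₂) := by
  obtain ⟨b₁, h₁⟩ := h₁
  obtain ⟨b₂, h₂⟩ := h₂
  refine ⟨b₁ + b₂ + 1, ?_⟩
  have := h₁.append h₂ hd
  rw [h] at this
  convert this using 1
  simp only [Multiset.replicate_add, Multiset.replicate_one]
  abel

lemma singleton (n : ℕ) : GridPath x {n} n n 0 := ⟨0, by simpa using PathOn.singleton n⟩

lemma run (i m : ℕ) : GridPath x {n | i ≤ n ∧ n ≤ i + m} i (i + m) m :=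
  ⟨0, by simpa using PathOn.run i m⟩

lemma mod_div {x c : ℕ} (hc : c < x) (k : ℕ) : (c + x * k) % x = c ∧ (c + x * k) / x = k := by
  have hx : 0 < x := by omega
  rw [Nat.add_mul_mod_self_left, Nat.mod_eq_of_lt hc, Nat.add_mul_div_left _ _ hx,
    Nat.div_eq_of_lt hc]
  simp

/-- `n` lies in column `c` and row `k` of the grid of width `x`. -/
lemma eq_iff {x c : ℕ} (hc : c < x) (k n : ℕ) : n = c + x * k ↔ n % x = c ∧ n / x = k := by
  constructor
  · rintro rfl
    exact mod_div hc k
  · rintro ⟨rfl, rfl⟩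
    exact (Nat.mod_add_div n x).symm

/-- The part of column `c` between rows `i` and `i + m`, traversed upwards. -/
lemma column {c : ℕ} (hc : c < x) (i m : ℕ) :
    GridPath x {n | n % x = c ∧ i ≤ n / x ∧ n / x ≤ i + m} (c + x * i) (c + x * (i + m)) 0 := by
  induction m with
  | zero =>
    refine (singleton _).congr fun n => ?_
    rw [Set.mem_singleton_iff, eq_iff hc]
    simp only [Set.mem_ofPred_eq]
    omega
  | succ m ih =>
    refine (ih.append_x (singleton (c + x * (i + (m + 1)))) (fun n hn => ?_) ?_).congr fun n => ?_
    · rw [Set.mem_singleton_iff, eq_iff hc]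
      simp only [Set.mem_ofPred_eq] at hn
      omega
    · rw [Nat.dist_add_add_left, Nat.dist_mul_left]
      simp [Nat.dist, Nat.add_sub_add_left]
    · rw [Set.mem_union, Set.mem_singleton_iff, eq_iff hc]
      simp only [Set.mem_ofPred_eq]
      omega

/-- The boustrophedon through columns `c, …, c + n` of the grid of width `x`, where column `i` has
height `h i`. It starts upwards from the bottom of column `c` and changes column at the top after
an even number of columns have been completed before the current one, where the two heights have to
agree, and at the bottom otherwise. -/
lemma zigzag (h : ℕ → ℕ) (c n : ℕ) (hx : c + n < x) (hpos : ∀ i ≤ n, 1 ≤ h (c + i))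
    (htop : ∀ i < n, Even i → h (c + i) = h (c + i + 1)) :
    GridPath x {m | c ≤ m % x ∧ m % x ≤ c + n ∧ m / x < h (m % x)} c
      (if Even n then c + n + x * (h (c + n) - 1) else c + n) n := by
  induction n with
  | zero =>
    have hc := column (x := x) (c := c) (by omega) 0 (h c - 1)
    have := hpos 0 le_rfl
    simp only [add_zero, zero_add, mul_zero, Nat.zero_le, true_and] at hc this
    simp only [Even.zero, if_true, add_zero]
    refine hc.congr fun m => ?_
    simp only [Set.mem_ofPred_eq]
    constructor
    · rintro ⟨rfl, h2⟩; omega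
    · rintro ⟨h1, h2, h3⟩
      obtain rfl : c = m % x := by omega
      omega
  | succ n ih =>
    have ih := ih (by omega) (fun i hi => hpos i (by omega)) fun i hi => htop i (by omega)
    have hc := column (x := x) (c := c + n + 1) (by omega) 0 (h (c + n + 1) - 1)
    have hp := hpos (n + 1) le_rfl
    simp only [zero_add, mul_zero, add_zero, Nat.zero_le, true_and] at hc
    rw [← add_assoc] at hp ⊢
    have hset : ∀ m, m ∈ {m | c ≤ m % x ∧ m % x ≤ c + n ∧ m / x < h (m % x)} ∪
        {m | m % x = c + n + 1 ∧ m / x ≤ h (c + n + 1) - 1} ↔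
        m ∈ {m | c ≤ m % x ∧ m % x ≤ c + n + 1 ∧ m / x < h (m % x)} := by
      intro m
      simp only [Set.mem_ofPred_eq, Set.mem_union]
      constructor
      · rintro (h1 | ⟨h1, h2⟩)
        · omega
        · rw [h1]; omega
      · rintro ⟨h1, h2, h3⟩
        by_cases h4 : m % x = c + n + 1
        · rw [h4] at h3; omega
        · omega
    have hdisj : ∀ m ∈ {m | c ≤ m % x ∧ m % x ≤ c + n ∧ m / x < h (m % x)},
        m ∉ {m | m % x = c + n + 1 ∧ m / x ≤ h (c + n + 1) - 1} := by
      intro m h1 h2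
      simp only [Set.mem_ofPred_eq] at h1 h2
      omega
    by_cases he : Even n
    · rw [if_pos he] at ih
      rw [if_neg (by simpa [Nat.even_add_one] using he)]
      refine (ih.append_one hc.reverse hdisj ?_).congr hset
      rw [htop n (by omega) he]
      unfold Nat.dist
      omega
    · rw [if_neg he] at ih
      rw [if_pos (by simpa [Nat.even_add_one] using he)]
      refine (ih.append_one hc hdisj ?_).congr hset
      unfold Nat.dist
      omega

end GridPath


/-- The height of column `c` when `{0, …, x * q + r - 1}` is arranged in rows of length `x`. -/
def colHeight (q r c : ℕ) : ℕ := if c < r then q + 1 else q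

lemma lt_iff_div_lt_colHeight {x : ℕ} (hx : 0 < x) (q r n : ℕ) (hr : r < x) :
    n < x * q + r ↔ n / x < colHeight q r (n % x) := by
  have hn := Nat.mod_add_div n x
  have hc := Nat.mod_lt n hx
  generalize n % x = c at *
  generalize n / x = k at *
  subst hn
  unfold colHeight
  rcases lt_trichotomy k q with h | rfl | h
  · have : x * (k + 1) ≤ x * q := Nat.mul_le_mul_left x h
    rw [mul_add, mul_one] at this
    split_ifs <;> omega
  · split_ifs <;> omega
  · have : x * (q + 1) ≤ x * k := Nat.mul_le_mul_left x h
    rw [mul_add, mul_one] at this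
    split_ifs <;> omega

lemma GridPath.pathOn {x v s t a b : ℕ} (h : GridPath x (Set.Iio v) s t a) (hv : v = a + b + 1) :
    PathOn (Set.Iio (a + b + 1)) s t (Multiset.replicate a 1 + Multiset.replicate b x) := by
  subst hv
  obtain ⟨b', hb⟩ := h
  have := hb.card_add_one
  simp only [Multiset.card_add, Multiset.card_replicate] at this
  obtain rfl : b' = b := by omega
  exact hb

/-- The full zigzag, for an even number of tall columns. -/
lemma gridPath_of_even {x q r : ℕ} (hr : r < x) (hq : 1 ≤ q) (he : Even r) :
    ∃ t, GridPath x (Set.Iio (x * q + r)) 0 t (x - 1) := by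
  have h := GridPath.zigzag (x := x) (colHeight q r) 0 (x - 1) (by omega)
    (fun i _ => by unfold colHeight; split_ifs <;> omega) fun i hi h2 => by
      unfold colHeight
      split_ifs <;> grind
  refine ⟨_, h.congr fun n => ?_⟩
  have := Nat.mod_lt n (show 0 < x by omega)
  rw [Set.mem_Iio, lt_iff_div_lt_colHeight (by omega) q r n hr]
  simp only [Set.mem_ofPred_eq]
  omega

/-- For an odd number of tall columns and even `x`, the zigzag runs through columns `1, …, x - 1`
and then crosses from the top of the last column to the next integer, at the top of column `0`,
which it descends. This is the reverse of the path in the statement. -/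
lemma gridPath_of_odd_of_even {x q r : ℕ} (hr : r < x) (hq : 1 ≤ q) (ho : Odd r) (he : Even x) :
    ∃ t, GridPath x (Set.Iio (x * q + r)) 0 t (x - 1) := by
  have hr0 := ho.pos
  have hx2 : 2 ≤ x := by omega
  have h := GridPath.zigzag (x := x) (colHeight q r) 1 (x - 2) (by omega)
    (fun i _ => by unfold colHeight; split_ifs <;> omega) fun i hi h2 => by
      unfold colHeight
      split_ifs <;> grind
  rw [if_pos (by grind), show 1 + (x - 2) = x - 1 by omega,
    show colHeight q r (x - 1) = q by unfold colHeight; rw [if_neg (by omega)]] at h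
  have hc := (GridPath.column (x := x) (c := 0) (by omega) 0 q).reverse
  simp only [zero_add, mul_zero, Nat.zero_le, true_and] at hc
  have hg := h.append_one hc (fun n h1 h2 => by
    simp only [Set.mem_ofPred_eq] at h1 h2; omega) (by
      obtain ⟨q, rfl⟩ := Nat.exists_eq_add_of_le' hq
      rw [Nat.add_sub_cancel, mul_add]
      unfold Nat.dist
      omega)
  rw [show x - 2 + 0 + 1 = x - 1 by omega] at hg
  refine ⟨_, hg.reverse.congr fun n => ?_⟩
  have := Nat.mod_lt n (show 0 < x by omega)
  rw [Set.mem_Iio, lt_iff_div_lt_colHeight (by omega) q r n hr]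
  simp only [Set.mem_ofPred_eq, Set.mem_union]
  by_cases h0 : n % x = 0
  · rw [h0, colHeight, if_pos hr0]
    omega
  · omega

/-- Two rows, the upper one of odd length: a zigzag through columns `1, …, r - 1`, a run to the end
of the lower row and on to `x`, and a last step to `0`. This is the reverse of the path in the
statement. -/
lemma gridPath_of_odd_two_rows {x r : ℕ} (hr : r < x) (ho : Odd r) :
    ∃ t, GridPath x (Set.Iio (x + r)) 0 t (x - 1) := by
  have hr0 := ho.pos
  suffices h : ∃ s, GridPath x {n | 1 ≤ n ∧ n < x + r} s x (x - 1) by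
    obtain ⟨s, h⟩ := h
    refine ⟨s, ((h.append_x (GridPath.singleton 0) (by grind) (by simp [Nat.dist])).reverse).congr
      fun n => ?_⟩
    simp only [Set.mem_union, Set.mem_ofPred_eq, Set.mem_singleton_iff, Set.mem_Iio]
    omega
  by_cases h1 : r = 1
  · subst h1
    have := GridPath.run (x := x) 1 (x - 1)
    rw [show 1 + (x - 1) = x by omega] at this
    exact ⟨1, this.congr fun n => by simp only [Set.mem_ofPred_eq]; omega⟩
  · have h3 : 3 ≤ r := by grind
    have h := GridPath.zigzag (x := x) (fun _ => 2) 1 (r - 2) (by omega) (by simp) (by simp)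
    rw [if_neg (by grind), show 1 + (r - 2) = r - 1 by omega] at h
    have hrun := GridPath.run (x := x) r (x - r)
    rw [show r + (x - r) = x by omega] at hrun
    have key : ∀ n, (1 ≤ n % x ∧ n % x ≤ r - 1 ∧ n / x < 2) ↔
        (1 ≤ n ∧ n ≤ r - 1) ∨ (x + 1 ≤ n ∧ n < x + r) := by
      intro n
      have hn := Nat.mod_add_div n x
      have hc := Nat.mod_lt n (show 0 < x by omega)
      generalize n % x = c at *
      generalize n / x = k at *
      subst hn
      rcases k with _ | _ | k
      · omega
      · omega
      · have : x * 2 ≤ x * (k + 1 + 1) := Nat.mul_le_mul_left x (by omega)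
        omega
    have hg := h.append_one hrun (fun n h1 h2 => by
      simp only [Set.mem_ofPred_eq, key] at h1 h2; omega) (by unfold Nat.dist; omega)
    rw [show r - 2 + (x - r) + 1 = x - 1 by omega] at hg
    refine ⟨_, hg.congr fun n => ?_⟩
    simp only [Set.mem_ofPred_eq, Set.mem_union, key]
    omega

/-- For odd `x` and an even, positive number of tall columns, the full zigzag can be modified in its
last two columns `x - 2`, `x - 1` to use one more step `1` and one step `x` less: it changes from
column `x - 2` to column `x - 1` in row `q - 1`, descends, and returns to column `x - 2` at the
bottom. -/
lemma gridPath_of_even_of_odd {x q r : ℕ} (hr : r < x) (hq : 2 ≤ q) (hr0 : 1 ≤ r) (he : Even r)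
    (ho : Odd x) : ∃ t, GridPath x (Set.Iio (x * q + r)) 0 t x := by
  have hx3 : 3 ≤ x := by grind
  have h := GridPath.zigzag (x := x) (colHeight q r) 0 (x - 3) (by omega)
    (fun i _ => by unfold colHeight; split_ifs <;> omega) fun i hi h2 => by
      unfold colHeight
      split_ifs <;> grind
  have hh : colHeight q r (x - 3) = colHeight q r (x - 2) := by
    unfold colHeight
    split_ifs <;> grind
  have hge : q ≤ colHeight q r (x - 2) := by unfold colHeight; split_ifs <;> omega
  have hlast : colHeight q r (x - 1) = q := by unfold colHeight; rw [if_neg (by omega)]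
  rw [if_pos (by grind)] at h
  simp only [zero_add, Nat.zero_le, true_and] at h
  have hA := (GridPath.column (x := x) (c := x - 2) (by omega) (q - 1)
    (colHeight q r (x - 2) - q)).reverse
  have hB := (GridPath.column (x := x) (c := x - 1) (by omega) 0 (q - 1)).reverse
  have hC := GridPath.column (x := x) (c := x - 2) (by omega) 0 (q - 2)
  simp only [zero_add, mul_zero, add_zero, Nat.zero_le, true_and] at hB hC
  have g1 := h.append_one hA (fun n h1 h2 => by
    simp only [Set.mem_ofPred_eq] at h1 h2; omega) (by
      rw [hh, show q - 1 + (colHeight q r (x - 2) - q) = colHeight q r (x - 2) - 1 by omega]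
      unfold Nat.dist
      omega)
  have g2 := g1.append_one hB (fun n h1 h2 => by
    simp only [Set.mem_ofPred_eq, Set.mem_union] at h1 h2; omega) (by
      unfold Nat.dist
      omega)
  have g3 := g2.append_one hC (fun n h1 h2 => by
    simp only [Set.mem_ofPred_eq, Set.mem_union] at h1 h2; omega) (by
      unfold Nat.dist
      omega)
  rw [show x - 3 + 0 + 1 + 0 + 1 + 0 + 1 = x by omega] at g3
  refine ⟨_, g3.congr fun n => ?_⟩
  have := Nat.mod_lt n (show 0 < x by omega)
  rw [Set.mem_Iio, lt_iff_div_lt_colHeight (by omega) q r n hr]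
  simp only [Set.mem_ofPred_eq, Set.mem_union]
  by_cases h1 : n % x = x - 1
  · rw [h1, hlast]
    omega
  · by_cases h2 : n % x = x - 2
    · rw [h2]
      omega
    · omega

/-- Any number of steps `x` can be accommodated, together with at most `x` steps `1`, by a path on
an initial segment of `ℕ` starting at `0`. -/
lemma exists_pathOn_one_x {x : ℕ} (hx : 1 ≤ x) (b : ℕ) : ∃ a ≤ x, ∃ t,
    PathOn (Set.Iio (a + b + 1)) 0 t (Multiset.replicate a 1 + Multiset.replicate b x) := by
  have hb := Nat.mod_add_div b x
  have hr := Nat.mod_lt b hx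
  generalize b % x = r at *
  generalize b / x = m at *
  subst hb
  have hm := mul_add x m 1
  rcases Nat.even_or_odd r with he | ho
  · obtain ⟨t, h⟩ := gridPath_of_even (q := m + 1) hr (by omega) he
    exact ⟨x - 1, by omega, t, h.pathOn (by omega)⟩
  · rcases Nat.even_or_odd x with hxe | hxo
    · obtain ⟨t, h⟩ := gridPath_of_odd_of_even (q := m + 1) hr (by omega) ho hxe
      exact ⟨x - 1, by omega, t, h.pathOn (by omega)⟩
    · rcases Nat.eq_zero_or_pos m with rfl | hm0
      · obtain ⟨t, h⟩ := gridPath_of_odd_two_rows hr ho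
        exact ⟨x - 1, by omega, t, h.pathOn (by omega)⟩
      · have hr1 : r + 1 < x := by grind
        obtain ⟨t, h⟩ := gridPath_of_even_of_odd (q := m + 1) hr1 (by omega) (by omega)
          ho.add_one hxo
        exact ⟨x, le_rfl, t, h.pathOn (by omega)⟩

/-! ### Three step lengths -/

/-- A reflected path with steps `1, x`, a run of ones, and a path with steps `1, y`, end to end. -/
lemma exists_pathOn_three {x y : ℕ} (hx : 1 ≤ x) (hy : 1 ≤ y) (a b c : ℕ) (ha : x + y + 1 ≤ a) :
    ∃ s t, PathOn (Set.Iio (a + b + c + 1)) s t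
      (Multiset.replicate a 1 + Multiset.replicate b x + Multiset.replicate c y) := by
  obtain ⟨a₁, ha₁, t₁, h₁⟩ := exists_pathOn_one_x hx b
  obtain ⟨a₂, ha₂, t₂, h₂⟩ := exists_pathOn_one_x hy c
  obtain ⟨m, rfl⟩ : ∃ m, a = a₁ + a₂ + m + 1 := ⟨a - a₁ - a₂ - 1, by omega⟩
  -- `m` ones extend the first path beyond its last vertex; one more joins the second path.
  obtain ⟨s, hX⟩ : ∃ s, PathOn (Set.Iio (a₁ + b + m + 1)) s (a₁ + b + m)
      (Multiset.replicate (a₁ + m) 1 + Multiset.replicate b x) := by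
    rcases Nat.eq_zero_or_pos m with rfl | hm
    · exact ⟨_, h₁.reflect.reverse⟩
    · have h := h₁.reflect.reverse.append (PathOn.run (a₁ + b + 1) (m - 1)) fun n h1 h2 => by
        simp only [Set.mem_ofPred_eq, Set.mem_Iio] at h1 h2; omega
      rw [show Nat.dist (a₁ + b - 0) (a₁ + b + 1) = 1 by unfold Nat.dist; omega,
        show a₁ + b + 1 + (m - 1) = a₁ + b + m by omega] at h
      refine ⟨a₁ + b - t₁, ?_⟩
      convert h.congr (S₂ := Set.Iio (a₁ + b + m + 1)) fun n => by
        simp only [Set.mem_ofPred_eq, Set.mem_Iio, Set.mem_union]; omega using 1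
      obtain ⟨m, rfl⟩ := Nat.exists_eq_add_of_le' hm
      simp only [Nat.add_sub_cancel, Multiset.replicate_add, Multiset.replicate_one]
      abel
  have h := hX.append (h₂.shift (a₁ + b + m + 1)) fun n h1 h2 => by
    simp only [Set.mem_ofPred_eq, Set.mem_Iio] at h1 h2; omega
  rw [show Nat.dist (a₁ + b + m) (0 + (a₁ + b + m + 1)) = 1 by unfold Nat.dist; omega] at h
  refine ⟨s, t₂ + (a₁ + b + m + 1), ?_⟩
  convert h.congr (S₂ := Set.Iio (a₁ + a₂ + m + 1 + b + c + 1)) fun n => by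
    simp only [Set.mem_ofPred_eq, Set.mem_Iio, Set.mem_union]; omega using 1
  simp only [Multiset.replicate_add, Multiset.replicate_one]
  abel


/-! ### Multiplication by a unit modulo `v` -/

/-- The cyclic length of an integer modulo `v`: its distance to the nearest multiple of `v`. -/
def cyclicLength (v n : ℕ) : ℕ := min (n % v) (v - n % v)

lemma cyclicLength_eq {v n t : ℕ} (hv : 0 < v) (ht : 2 * t ≤ v)
    (h : (v : ℤ) ∣ n - t ∨ (v : ℤ) ∣ n + t) : cyclicLength v n = t := by
  have hn := Nat.mod_add_div n v
  have hlt := Nat.mod_lt n hv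
  unfold cyclicLength
  generalize n % v = c at *
  generalize n / v = k at *
  have hv' : (0 : ℤ) < v := by exact_mod_cast hv
  subst hn
  push_cast at h
  rcases h with h | h
  · have h' : (v : ℤ) ∣ (c : ℤ) - t := by
      have := dvd_sub h (dvd_mul_right (v : ℤ) k)
      ring_nf at this ⊢
      exact this
    have := Int.eq_zero_of_abs_lt_dvd h' (by rw [abs_lt]; omega)
    omega
  · have h' : (v : ℤ) ∣ (c : ℤ) + t := by
      have := dvd_sub h (dvd_mul_right (v : ℤ) k)
      ring_nf at this ⊢
      exact this
    rcases Nat.eq_zero_or_pos (c + t) with h0 | h0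
    · omega
    · have := Int.eq_zero_of_abs_lt_dvd (x := (c : ℤ) + t - v) (dvd_sub_self_right.2 h')
        (by rw [abs_lt]; omega)
      omega

/-- Every natural number is congruent to its cyclic length up to sign. -/
lemma dvd_sub_or_dvd_add_cyclicLength {v : ℕ} (hv : 0 < v) (n : ℕ) :
    (v : ℤ) ∣ n - cyclicLength v n ∨ (v : ℤ) ∣ n + cyclicLength v n := by
  have hn := Nat.mod_add_div n v
  have hlt := Nat.mod_lt n hv
  unfold cyclicLength
  generalize n % v = c at *
  generalize n / v = k at *
  subst hn
  rcases le_total c (v - c) with h | h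
  · left
    rw [min_eq_left h]
    exact ⟨k, by push_cast; ring⟩
  · right
    rw [min_eq_right h]
    exact ⟨k + 1, by push_cast [hlt.le]; ring⟩

/-- The vertex `u * n` modulo `v`. -/
def mulVertex {v : ℕ} (hv : 0 < v) (u n : ℕ) : Fin v := ⟨u * n % v, Nat.mod_lt _ hv⟩

lemma edgeLength_mulVertex {v : ℕ} (hv : 0 < v) (u i j : ℕ) :
    edgeLength v s(mulVertex hv u i, mulVertex hv u j) = cyclicLength v (u * Nat.dist i j) := by
  wlog hij : i ≤ j generalizing i j
  · rw [Sym2.eq_swap, this j i (by omega), Nat.dist_comm]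
  symm
  have hi := Nat.mod_lt (u * i) hv
  have hj := Nat.mod_lt (u * j) hv
  have hi' := Nat.mod_add_div (u * i) v
  have hj' := Nat.mod_add_div (u * j) v
  change _ = min (Nat.dist (u * i % v) (u * j % v)) (v - Nat.dist (u * i % v) (u * j % v))
  obtain ⟨d, rfl⟩ := Nat.exists_eq_add_of_le hij
  rw [show Nat.dist i (i + d) = d by unfold Nat.dist; omega]
  generalize u * i % v = p at *
  generalize u * (i + d) % v = q at *
  generalize u * i / v = k at *
  generalize u * (i + d) / v = m at *
  zify at hi' hj'
  refine cyclicLength_eq hv (by unfold Nat.dist; omega) ?_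
  have e : ((u * d : ℕ) : ℤ) = (q - p) + v * (m - k) := by push_cast; linear_combination hi' - hj'
  have hdiv : ∀ a b : ℤ, a = v * b → (v : ℤ) ∣ a := fun a b h => ⟨b, h⟩
  rw [e]
  unfold Nat.dist
  rcases le_total p q with h | h
  · rcases le_total (p - q + (q - p)) (v - (p - q + (q - p))) with h' | h'
    · left
      rw [min_eq_left h', Nat.sub_eq_zero_of_le h, zero_add, Nat.cast_sub h]
      exact hdiv _ (m - k) (by ring)
    · right
      rw [min_eq_right h', Nat.sub_eq_zero_of_le h, zero_add, Nat.cast_sub (by omega),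
        Nat.cast_sub h]
      exact hdiv _ (m - k + 1) (by ring)
  · rcases le_total (p - q + (q - p)) (v - (p - q + (q - p))) with h' | h'
    · right
      rw [min_eq_left h', Nat.sub_eq_zero_of_le h, add_zero, Nat.cast_sub h]
      exact hdiv _ (m - k) (by ring)
    · left
      rw [min_eq_right h', Nat.sub_eq_zero_of_le h, add_zero, Nat.cast_sub (by omega),
        Nat.cast_sub h]
      exact hdiv _ (m - k - 1) (by ring)

lemma mulVertex_inj {v u : ℕ} (hv : 0 < v) (hu : Nat.Coprime v u) {i j : ℕ} (hi : i < v)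
    (hj : j < v) (h : mulVertex hv u i = mulVertex hv u j) : i = j := by
  have h' : u * i ≡ u * j [MOD v] := Fin.ext_iff.1 h
  exact (Nat.ModEq.cancel_left_of_coprime hu h').eq_of_lt_of_lt hi hj

lemma map_edgeLength_edges_ofSupport {v : ℕ} (hv : 0 < v) (u : ℕ) : ∀ (l : List ℕ) (hne hc),
    ((SimpleGraph.Walk.ofSupport (G := ⊤) (l.map (mulVertex hv u)) hne hc).edges :
      Multiset (Sym2 (Fin v))).map (edgeLength v) =
    (steps l).map fun n => cyclicLength v (u * n)
  | [], hne, _ => by simp at hne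
  | [_], _, _ => rfl
  | a :: b :: l, _, hc => by
      have ih := map_edgeLength_edges_ofSupport hv u (b :: l) (by simp)
        (by simpa using hc.of_cons)
      rw [steps, Multiset.map_cons, ← ih, ← edgeLength_mulVertex hv]
      rfl

/-- A path on `{0, …, v - 1}` multiplied by a unit modulo `v` is a Hamiltonian path, and its step
lengths are multiplied by that unit. -/
lemma PathOn.realizable {v u s t : ℕ} {M : Multiset ℕ} (h : PathOn (Set.Iio v) s t M)
    (hu : Nat.Coprime v u) : Realizable v (M.map fun n => cyclicLength v (u * n)) := by
  have hv : 0 < v := lt_of_le_of_lt (Nat.zero_le s) h.start_mem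
  obtain ⟨l, h1, h2, h3, h4, rfl⟩ := h
  have hne : l.map (mulVertex hv u) ≠ [] := by
    intro h
    rw [List.map_eq_nil_iff] at h
    simp [h] at h3
  have hnd : (l.map (mulVertex hv u)).Nodup :=
    h1.map_on fun a ha b hb hab => mulVertex_inj hv hu ((h2 a).1 ha) ((h2 b).1 hb) hab
  have hc : (l.map (mulVertex hv u)).IsChain (⊤ : SimpleGraph (Fin v)).Adj :=
    (List.Pairwise.isChain hnd).imp fun a b hab => by simpa using hab
  refine ⟨_, _, SimpleGraph.Walk.ofSupport _ hne hc, ?_, map_edgeLength_edges_ofSupport hv u l _ _⟩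
  have hp : (SimpleGraph.Walk.ofSupport _ hne hc).IsPath := by
    rw [SimpleGraph.Walk.isPath_def, SimpleGraph.Walk.support_ofSupport]
    exact hnd
  refine hp.isHamiltonian_of_mem fun w => ?_
  rw [SimpleGraph.Walk.support_ofSupport]
  -- An injective map between sets of `v` elements is onto.
  have hcard : (l.map (mulVertex hv u)).toFinset = Finset.univ := by
    refine Finset.eq_univ_of_card _ ?_
    rw [List.toFinset_card_of_nodup hnd, List.length_map, Fintype.card_fin,
      ← List.toFinset_card_of_nodup h1, show l.toFinset = Finset.range v by ext n; simp [h2],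
      Finset.card_range]
  rw [← List.mem_toFinset, hcard]
  exact Finset.mem_univ w


/-! ### The support `{1, x, y}` for `v ≡ ±1 (mod x * y)` -/

lemma realizable_map_cyclicLength {v u X Y a b c : ℕ} (hu : Nat.Coprime v u) (hX : 1 ≤ X)
    (hY : 1 ≤ Y) (ha : X + Y + 1 ≤ a) (hv : a + b + c + 1 = v) :
    Realizable v (Multiset.replicate a (cyclicLength v u) +
      Multiset.replicate b (cyclicLength v (u * X)) +
      Multiset.replicate c (cyclicLength v (u * Y))) := by
  obtain ⟨s, t, h⟩ := exists_pathOn_three hX hY a b c ha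
  rw [hv] at h
  simpa only [Multiset.map_add, Multiset.map_replicate, mul_one] using h.realizable hu

lemma coprime_of_eq {v u w : ℕ} {ε : ℤ} (hε : ε = 1 ∨ ε = -1) (h : (v : ℤ) = w * u + ε) :
    Nat.Coprime v u := by
  rw [← Nat.isCoprime_iff_coprime]
  have h2 : ε * ε = 1 := by rcases hε with rfl | rfl <;> norm_num
  exact ⟨ε, -ε * w, by rw [h]; linear_combination h2⟩

/-- With `k` the quotient of `v` by `x * y`, three cases cover all multiplicities: many ones, where
the linear construction applies directly; many `y`s, where it is applied to `1, k * x, k * x ^ 2`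
and the result multiplied by `y`; and many `x`s, where it is applied to `1`, `k * y` and the cyclic
length of `k * y ^ 2`, and the result multiplied by `x`. -/
lemma realizable_three {v x y k a b c : ℕ} {ε : ℤ} (hε : ε = 1 ∨ ε = -1)
    (hv : (v : ℤ) = k * x * y + ε) (hx : 3 ≤ x) (hxy : 2 * x ^ 2 + 2 * x + 2 * y + 2 ≤ x * y)
    (hk : x + y + 4 ≤ k) (habc : a + b + c + 1 = v) :
    Realizable v (Multiset.replicate a 1 + Multiset.replicate b x + Multiset.replicate c y) := by
  have hy : 1 ≤ y := by
    rcases Nat.eq_zero_or_pos y with rfl | h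
    · nlinarith
    · exact h
  have hε1 : -1 ≤ ε ∧ ε ≤ 1 := by rcases hε with rfl | rfl <;> norm_num
  have hv0 : 0 < v := by omega
  have hkx : k * (2 * x ^ 2 + 2 * x + 2 * y + 2) ≤ k * (x * y) := Nat.mul_le_mul_left k hxy
  have hkv : k * (2 * x ^ 2 + 2 * x + 2 * y + 2) ≤ v + 1 := by
    zify at hkx ⊢
    linarith
  have hkk : 2 * (x + y) + 1 ≤ v := by nlinarith
  have hsign : ∀ n t : ℕ, 2 * t ≤ v → (∃ q : ℤ, (n : ℤ) + ε * t = v * q) →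
      cyclicLength v n = t := by
    rintro n t ht ⟨q, hq⟩
    refine cyclicLength_eq hv0 ht ?_
    rcases hε with rfl | rfl
    · exact Or.inr ⟨q, by linarith⟩
    · exact Or.inl ⟨q, by linarith⟩
  have hself : ∀ t : ℕ, 2 * t ≤ v → cyclicLength v t = t := fun t ht =>
    cyclicLength_eq hv0 ht (Or.inl (by simp))
  by_cases h1 : x + y + 1 ≤ a
  · have h := realizable_map_cyclicLength (u := 1) (Nat.coprime_one_right v) (by omega) hy h1 habc
    rwa [one_mul, one_mul, hself 1 (by omega), hself x (by omega), hself y (by omega)] at h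
  by_cases h2 : k * x + k * x ^ 2 + 1 ≤ c
  · have hu : Nat.Coprime v y := coprime_of_eq (w := k * x) hε (by push_cast; exact hv)
    have h := realizable_map_cyclicLength (b := a) (c := b) hu (X := k * x) (Y := k * x ^ 2)
      (Nat.mul_pos (by omega) (by omega)) (Nat.mul_pos (by omega) (by positivity)) h2 (by omega)
    rw [hself y (by omega),
      hsign (y * (k * x)) 1 (by omega) ⟨1, by rw [hv]; push_cast; ring⟩,
      hsign (y * (k * x ^ 2)) x (by omega) ⟨x, by rw [hv]; push_cast; ring⟩] at h
    convert h using 1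
    abel
  · have hu : Nat.Coprime v x := coprime_of_eq (w := k * y) hε (by rw [hv]; push_cast; ring)
    have hle : 2 * cyclicLength v (k * y ^ 2) ≤ v := by unfold cyclicLength; omega
    have hYdvd := dvd_sub_or_dvd_add_cyclicLength hv0 (k * y ^ 2)
    generalize cyclicLength v (k * y ^ 2) = Y at *
    have hxY : cyclicLength v (x * Y) = y := by
      have key : (v : ℤ) ∣ x * (k * y ^ 2 : ℕ) + ε * y := ⟨y, by rw [hv]; push_cast; ring⟩
      have hcases : (v : ℤ) ∣ x * Y + ε * y ∨ (v : ℤ) ∣ x * Y - ε * y := by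
        rcases hYdvd with h | h
        · left
          have := dvd_sub key (h.mul_left (x : ℤ))
          ring_nf at this ⊢
          exact this
        · right
          have := dvd_sub (h.mul_left (x : ℤ)) key
          ring_nf at this ⊢
          exact this
      refine cyclicLength_eq hv0 (by omega) ?_
      push_cast
      rcases hε with rfl | rfl
      · simpa [or_comm, sub_eq_add_neg] using hcases
      · simpa [or_comm, sub_eq_add_neg] using hcases
    have hY : 1 ≤ Y := by
      rcases Nat.eq_zero_or_pos Y with rfl | h
      · have h0 : cyclicLength v 0 = 0 := hself 0 (by omega)
        rw [mul_zero, h0] at hxY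
        omega
      · exact h
    -- This is where the bound on `y` enters: `a` and `c` are small and `2 * Y ≤ v`, so it suffices
    -- that `v / 2` exceeds `k * (x ^ 2 + x + y)` by a constant, and `x * y` is large enough.
    have hb : k * y + Y + 1 ≤ b := by nlinarith
    have h := realizable_map_cyclicLength (b := a) (c := c) hu (X := k * y)
      (Nat.mul_pos (by omega) (by omega)) hY hb (by omega)
    rw [hself x (by omega), hxY,
      hsign (x * (k * y)) 1 (by omega) ⟨1, by rw [hv]; push_cast; ring⟩] at h
    convert h using 1
    abel

lemma eq_replicate_of_toFinset_eq {L : Multiset ℕ} {x y : ℕ} (hx : 1 < x) (hxy : x < y)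
    (hL : L.toFinset = {1, x, y}) :
    L = Multiset.replicate (L.count 1) 1 + Multiset.replicate (L.count x) x +
      Multiset.replicate (L.count y) y := by
  ext n
  have hn : n ∈ L ↔ n = 1 ∨ n = x ∨ n = y := by
    rw [← Multiset.mem_toFinset, hL]
    simp
  simp only [Multiset.count_add, Multiset.count_replicate]
  by_cases h : n ∈ L
  · rcases hn.1 h with rfl | rfl | rfl <;> split_ifs <;> omega
  · rw [Multiset.count_eq_zero_of_notMem h]
    rw [hn] at h
    push Not at h
    rw [if_neg h.1.symm, if_neg h.2.1.symm, if_neg h.2.2.symm]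

lemma exists_eq_add_of_modEq {v x y : ℕ} (h : (v : ℤ) ≡ 1 [ZMOD ((x * y : ℕ) : ℤ)] ∨
    (v : ℤ) ≡ -1 [ZMOD ((x * y : ℕ) : ℤ)]) :
    ∃ k ε : ℤ, (ε = 1 ∨ ε = -1) ∧ (v : ℤ) = k * x * y + ε := by
  rcases h with h | h
  · obtain ⟨k, hk⟩ := h.symm.dvd
    exact ⟨k, 1, Or.inl rfl, by push_cast at hk; linear_combination hk⟩
  · obtain ⟨k, hk⟩ := h.symm.dvd
    exact ⟨k, -1, Or.inr rfl, by push_cast at hk; linear_combination hk⟩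

lemma isCoprimeInstance {v x y : ℕ} (h : (v : ℤ) ≡ 1 [ZMOD ((x * y : ℕ) : ℤ)] ∨
    (v : ℤ) ≡ -1 [ZMOD ((x * y : ℕ) : ℤ)]) {L : Multiset ℕ} (hL : L.toFinset = {1, x, y})
    (hI : IsInstance v L) : IsCoprimeInstance v L := by
  obtain ⟨k, ε, hε, hv⟩ := exists_eq_add_of_modEq h
  have h2 : ε * ε = 1 := by rcases hε with rfl | rfl <;> norm_num
  refine ⟨hI, fun l hl => ?_⟩
  have hl' : l = 1 ∨ l = x ∨ l = y := by
    rw [← Multiset.mem_toFinset, hL] at hl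
    simpa using hl
  rcases hl' with rfl | rfl | rfl
  · exact Nat.gcd_one_right v
  · exact Nat.isCoprime_iff_coprime.1 ⟨ε, -ε * k * y, by rw [hv]; linear_combination h2⟩
  · exact Nat.isCoprime_iff_coprime.1 ⟨ε, -ε * k * x, by rw [hv]; linear_combination h2⟩

/-- For a multiset of elements coprime to `v`, only the divisor `1` has multiples in it. -/
lemma IsCoprimeInstance.divisorCondition {v : ℕ} {L : Multiset ℕ} (h : IsCoprimeInstance v L) :
    DivisorCondition v L := by
  intro d hd
  by_cases h1 : d = 1
  · subst h1
    have := Multiset.card_le_card (Multiset.filter_le (fun l => 1 ∣ l) L)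
    have := h.1.1
    omega
  · rw [Multiset.filter_eq_nil.2 fun l hl hdl => h1 ?_]
    · simp
    · exact Nat.dvd_one.1 (h.2 l hl ▸ Nat.dvd_gcd hd hdl)

/-- All multisets with support `{1, x, y}` are realizable when `v` is large. -/
lemma realizable_of_modEq {v x y : ℕ} (hx : 2 < x)
    (hxy : 2 * x ^ 2 + 2 * x + 2 * y + 2 ≤ x * y) (hN : x * y * (x + y + 5) ≤ v)
    (h : (v : ℤ) ≡ 1 [ZMOD ((x * y : ℕ) : ℤ)] ∨ (v : ℤ) ≡ -1 [ZMOD ((x * y : ℕ) : ℤ)])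
    {L : Multiset ℕ} (hL : L.toFinset = {1, x, y}) (hI : IsInstance v L) : Realizable v L := by
  obtain ⟨k, ε, hε, hv⟩ := exists_eq_add_of_modEq h
  have hε1 : -1 ≤ ε ∧ ε ≤ 1 := by rcases hε with rfl | rfl <;> norm_num
  have hlt : x < y := by nlinarith
  have hp : 2 < x * y := by nlinarith
  have hk : (x : ℤ) + y + 4 ≤ k := by
    by_contra! hlt
    have h1 : (x : ℤ) * y * k ≤ x * y * (x + y + 3) :=
      mul_le_mul_of_nonneg_left (by omega) (by positivity)
    zify at hN hp
    nlinarith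
  lift k to ℕ using by omega
  have hL' := eq_replicate_of_toFinset_eq (by omega) hlt hL
  rw [hL']
  refine realizable_three hε hv hx hxy (by exact_mod_cast hk) ?_
  have := hI.1
  rw [hL'] at this
  simpa using this

end BHR

theorem mainTheorem6 (x y : ℕ) (hx : 2 < x)
    (hy : (2 * (x : ℝ) ^ 2 + 2 * x + 1) / ((x : ℝ) - 2) < y) :
    (∃ N : ℕ, ∀ v : ℕ, N ≤ v →
      ((v : ℤ) ≡ 1 [ZMOD ((x * y : ℕ) : ℤ)] ∨ (v : ℤ) ≡ -1 [ZMOD ((x * y : ℕ) : ℤ)]) →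
        BHR.BHRHoldsFor v {1, x, y}) ∧
    (∀ v : ℕ,
      ((v : ℤ) ≡ 1 [ZMOD ((x * y : ℕ) : ℤ)] ∨ (v : ℤ) ≡ -1 [ZMOD ((x * y : ℕ) : ℤ)]) →
        ∀ L : Multiset ℕ, L.toFinset = {1, x, y} → BHR.IsInstance v L →
          BHR.IsCoprimeInstance v L) ∧
    {v : ℕ |
      ((v : ℤ) ≡ 1 [ZMOD ((x * y : ℕ) : ℤ)] ∨ (v : ℤ) ≡ -1 [ZMOD ((x * y : ℕ) : ℤ)]) ∧
      (∃ L : Multiset ℕ, L.toFinset = {1, x, y} ∧ BHR.IsCoprimeInstance v L) ∧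
      BHR.BHRHoldsFor v {1, x, y} ∧
      BHR.CoprimeBHRHoldsFor v {1, x, y}}.Infinite := by
  have hxy : 2 * x ^ 2 + 2 * x + 2 * y + 2 ≤ x * y := by
    have hx' : (0 : ℝ) < (x : ℝ) - 2 := by
      have : (2 : ℝ) < x := by exact_mod_cast hx
      linarith
    rw [div_lt_iff₀ hx'] at hy
    have : (2 * x ^ 2 + 2 * x + 2 * y + 1 : ℝ) < x * y := by linarith
    exact_mod_cast this
  have hlt : x < y := by nlinarith
  refine ⟨⟨x * y * (x + y + 5), fun v hN h L hL hI => ?_⟩, fun v h L hL hI =>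
    BHR.isCoprimeInstance h hL hI, Set.infinite_of_forall_exists_gt fun n => ?_⟩
  · exact iff_of_true (BHR.realizable_of_modEq hx hxy hN h hL hI)
      (BHR.isCoprimeInstance h hL hI).divisorCondition
  · have hp : 0 < x * y := Nat.mul_pos (by omega) (by omega)
    set m := x + y + 5 + n with hm
    have hmod : ((x * y * m + 1 : ℕ) : ℤ) ≡ 1 [ZMOD ((x * y : ℕ) : ℤ)] :=
      (Int.modEq_iff_dvd.2 ⟨m, by push_cast; ring⟩).symm
    have hN : x * y * (x + y + 5) ≤ x * y * m + 1 :=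
      (Nat.mul_le_mul_left _ (by omega)).trans (Nat.le_succ _)
    have hmle : 2 * m ≤ x * y * m := Nat.mul_le_mul_right m (by nlinarith)
    refine ⟨x * y * m + 1, ⟨Or.inl hmod, ?_, fun L hL hI => ?_, fun L hL hI => ?_⟩, by omega⟩
    · let L : Multiset ℕ := Multiset.replicate (x * y * m - 2) 1 + {x, y}
      have hne : x * y * m - 2 ≠ 0 := by omega
      have hL : L.toFinset = {1, x, y} := by
        ext l
        simp [L, hne, or_left_comm]
      refine ⟨L, hL, BHR.isCoprimeInstance (Or.inl hmod) hL ⟨?_, fun l hl => ?_⟩⟩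
      · simp [L]
        omega
      · have : l = 1 ∨ l = x ∨ l = y := by
          rw [← Multiset.mem_toFinset, hL] at hl
          simpa using hl
        omega
    · exact iff_of_true (BHR.realizable_of_modEq hx hxy hN (Or.inl hmod) hL hI)
        (BHR.isCoprimeInstance (Or.inl hmod) hL hI).divisorCondition
    · exact BHR.realizable_of_modEq hx hxy hN (Or.inl hmod) hL hI.1
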